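/- For $1<p<\infty$ let $H^p$ be the Hardy space of holomorphic functions $f$ on the open unit disk $\mathbb{D}$ with \[ \|f\|_p := \left(\sup_{0\le r<1}\frac{1}{2\pi}\int_0^{2\pi}|f(re^{i\theta})|^p\,d\theta\right)^{1/p}<\infty . \] For $f\in H^p$, not identically zero, and an integer $n\ge 0$, the $n$-th optimal polynomial approximant (OPA) to $1/f$, denoted $q_{n,p}[f]$, is the unique complex polynomial $q$ of degree at most $n$ that minimizes $\|1-qf\|_p$ among all complex polynomials of degree at most $n$. Theorem. Let $p>2$ be an even integer. There exists a constant $\rho>0$, depending only on $p$, such that for every $f\in H^p$ with $f(0)\neq 0$ and all $a,w\in\mathbb{C}$: if $q_{1,p}[f](z)=a(z-w)$, then $|w|\ge\rho$. -/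

import Mathlib

open Set

noncomputable section

/-- The integral mean `(1 / 2π) ∫_0^{2π} |f (r e^{iθ})|^p dθ`. -/
def hardyMean (p : ℝ) (f : ℂ → ℂ) (r : ℝ) : ℝ :=
  (2 * Real.pi)⁻¹ * ∫ θ in (0 : ℝ)..(2 * Real.pi), ‖f (circleMap 0 r θ)‖ ^ p

/-- Membership in the Hardy space `H^p` of the open unit disk (only the values of `f` on the disk
matter): `f` is holomorphic there and its integral means over `0 ≤ r < 1` are bounded. -/
def MemHardy (p : ℝ) (f : ℂ → ℂ) : Prop :=
  DifferentiableOn ℂ f (Metric.ball 0 1) ∧ BddAbove (hardyMean p f '' Ico 0 1)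

/-- The norm of `H^p`, the `p`-th root of the supremum of the integral means over `0 ≤ r < 1`. It is
meaningful for `f` with `MemHardy p f`. -/
def hardyNorm (p : ℝ) (f : ℂ → ℂ) : ℝ :=
  (sSup (hardyMean p f '' Ico 0 1)) ^ (1 / p)

/-- `q` is the `n`-th optimal polynomial approximant to `1 / f` in `H^p`: it solves the problem of
minimizing `‖1 - q f‖_p` over the complex polynomials `q` of degree at most `n`. -/
def IsOPA (n : ℕ) (p : ℝ) (f : ℂ → ℂ) (q : Polynomial ℂ) : Prop :=
  q.natDegree ≤ n ∧
    ∀ s : Polynomial ℂ, s.natDegree ≤ n →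
      hardyNorm p (fun z => 1 - q.eval z * f z) ≤ hardyNorm p (fun z => 1 - s.eval z * f z)

end

open Real Metric

/-! ### Elementary inequalities -/

/-! For even `p`, `‖1 - v‖ ^ p` is a polynomial in `‖v‖ ^ 2 - 2 * v.re`, and equals `1 - p * v.re`
up to an error comparable, from both sides, to `‖v‖ ^ 2 + ‖v‖ ^ p`. Averaged over circles, this
turns `‖1 - g‖_p ^ p` into `1 - p * (g 0).re` plus a multiple of the energy of `g`.

Let `u = a (z - w) f` with `w` near 0. Beating the zero polynomial forces the energy of `u` to be
`O(‖w‖ ‖a f(0)‖)`, since `u(0) = -a w f(0)`. As `z - w` is bounded below near the unit circle, `a f`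
obeys the same bound (`IsOPA.energyMean_le`). Moving the root to a unimodular `-σ` makes the value
at 0 equal to `‖a f(0)‖`, at an energy cost still `O(‖w‖ ‖a f(0)‖)`. For small `‖w‖` this competitor
beats `u`, a contradiction once `a f(0) ≠ 0`, which `IsOPA.ne_zero` ensures. -/

lemma one_add_pow_le_quadratic (k : ℕ) {x : ℝ} (h1 : -1 ≤ x) (h3 : x ≤ 3) :
    (1 + x) ^ k ≤ 1 + k * x + k * 4 ^ k * x ^ 2 := by
  induction k with
  | zero => simp
  | succ k ih =>
    have h4 : (1 : ℝ) ≤ 4 ^ k := one_le_pow₀ (by norm_num)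
    have hk : (0 : ℝ) ≤ k := k.cast_nonneg
    have hx := sq_nonneg x
    calc (1 + x) ^ (k + 1) = (1 + x) ^ k * (1 + x) := pow_succ _ _
      _ ≤ (1 + k * x + k * 4 ^ k * x ^ 2) * (1 + x) := by gcongr; linarith
      _ = 1 + (k + 1) * x + (k + k * 4 ^ k * (1 + x)) * x ^ 2 := by ring
      _ ≤ 1 + (k + 1) * x + ((k + 1) * (4 ^ k * 4)) * x ^ 2 := by
        gcongr
        have h5 : (k : ℝ) ≤ 4 ^ k := by exact_mod_cast (Nat.lt_pow_self (by norm_num)).le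
        nlinarith [mul_nonneg (mul_nonneg hk (by linarith : (0 : ℝ) ≤ 4 ^ k)) (by linarith : 0 ≤ 3 - x)]
      _ = _ := by push_cast; ring

/-- Bernoulli's inequality with the top-degree term kept; that term supplies the `‖v‖ ^ p` part of
the lower Taylor bound. -/
lemma one_add_mul_add_pow_le {k : ℕ} (hk : 2 ≤ k) {x : ℝ} (hx : 0 ≤ x) :
    1 + k * x + x ^ k ≤ (1 + x) ^ k := by
  induction k, hk using Nat.le_induction with
  | base => norm_num; nlinarith
  | succ k hk ih =>
    have h0 : (0 : ℝ) ≤ k := k.cast_nonneg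
    have h1 : 0 ≤ x ^ k := by positivity
    calc 1 + ((k + 1 : ℕ) : ℝ) * x + x ^ (k + 1)
        ≤ (1 + k * x + x ^ k) * (1 + x) := by
          push_cast; rw [pow_succ]; nlinarith [mul_nonneg h0 (mul_nonneg hx hx)]
      _ ≤ (1 + x) ^ k * (1 + x) := by gcongr
      _ = _ := (pow_succ _ _).symm

lemma norm_one_sub_sq (v : ℂ) : ‖1 - v‖ ^ 2 = 1 + (‖v‖ ^ 2 - 2 * v.re) := by
  rw [← Complex.normSq_eq_norm_sq, ← Complex.normSq_eq_norm_sq, Complex.normSq_sub]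
  simp; ring

/-- Taylor's formula at `v = 0` for `‖1 - v‖ ^ p` has a remainder bounded below by a multiple of
`‖v‖ ^ 2 + ‖v‖ ^ p`. -/
lemma exists_le_norm_one_sub_pow {p : ℕ} (hp : 2 < p) (hpe : Even p) :
    ∃ c : ℝ, 0 < c ∧ ∀ v : ℂ, 1 - p * v.re + c * (‖v‖ ^ 2 + ‖v‖ ^ p) ≤ ‖1 - v‖ ^ p := by
  obtain ⟨k, hk⟩ := hpe
  obtain rfl : p = 2 * k := by omega
  have hk2 : 2 ≤ k := by omega
  have hk1 : (1 : ℝ) ≤ k := by exact_mod_cast (by omega : 1 ≤ k)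
  have h16 : (0 : ℝ) < 1 + 16 ^ k := by positivity
  refine ⟨(1 + 16 ^ k)⁻¹, inv_pos.2 h16, fun v => ?_⟩
  have hre := v.re_le_norm
  have hv := norm_nonneg v
  rw [pow_mul, pow_mul, norm_one_sub_sq]
  set x := ‖v‖ ^ 2 - 2 * v.re with hx
  set s := ‖v‖ ^ 2 with hs
  have hs0 : 0 ≤ s := by positivity
  have hx1 : -1 ≤ x := by nlinarith [sq_nonneg (‖v‖ - 1)]
  -- Bernoulli's linear part `1 + k * x` already exceeds `1 - p * v.re` by `k * s`, which is the
  -- quadratic gain.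
  have e : 1 - ((2 * k : ℕ) : ℝ) * v.re = 1 + k * x - k * s := by rw [hx]; push_cast; ring
  have hc : (1 + (16 : ℝ) ^ k)⁻¹ * (s + s ^ k) ≤ k * s + max 0 x ^ k := by
    rw [inv_mul_le_iff₀ h16]
    have hm : 0 ≤ max 0 x ^ k := by positivity
    -- For `‖v‖ ≤ 4` the term `k * s` dominates; beyond, `2 * v.re ≤ s / 2`, so `x ≥ s / 2` and `x ^
    -- k` controls `s ^ k`.
    rcases le_total s 16 with h | h
    · have : s ^ k ≤ 16 ^ k * s := by
        obtain ⟨j, rfl⟩ : ∃ j, k = j + 1 := ⟨k - 1, by omega⟩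
        rw [pow_succ, pow_succ]
        have : s ^ j ≤ 16 ^ j := by gcongr
        have : (0 : ℝ) ≤ 16 ^ j := by positivity
        nlinarith
      have : s + s ^ k ≤ (1 + 16 ^ k) * s := by linarith
      have h2 : s ≤ k * s + max 0 x ^ k := by nlinarith
      nlinarith
    · have h4 : 4 ≤ ‖v‖ := by nlinarith
      have hxs : s / 2 ≤ x := by nlinarith
      have h1 : s ^ k ≤ 2 ^ k * max 0 x ^ k := by
        rw [← mul_pow]; gcongr; linarith [le_max_right 0 x]
      have h2 : (2 : ℝ) ^ k ≤ 16 ^ k := by gcongr; norm_num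
      have h3 : s ≤ k * s := by nlinarith
      have h5 : (0 : ℝ) ≤ 16 ^ k := by positivity
      nlinarith [mul_le_mul_of_nonneg_right h2 hm, mul_nonneg h5 (mul_nonneg (by linarith : (0:ℝ) ≤ k) hs0)]
  have hb : 1 + k * x + max 0 x ^ k ≤ (1 + x) ^ k := by
    rcases le_total 0 x with h | h
    · rw [max_eq_right h]; exact one_add_mul_add_pow_le hk2 h
    · rw [max_eq_left h, zero_pow (by omega), add_zero]
      exact one_add_mul_le_pow (by linarith) k
  linarith

/-- Taylor's formula at `v = 0` for `‖1 - v‖ ^ p` has a remainder bounded above by a multiple of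
`‖v‖ ^ 2 + ‖v‖ ^ p`. -/
lemma exists_norm_one_sub_pow_le {p : ℕ} (hpe : Even p) :
    ∃ C : ℝ, 0 < C ∧ ∀ v : ℂ, ‖1 - v‖ ^ p ≤ 1 - p * v.re + C * (‖v‖ ^ 2 + ‖v‖ ^ p) := by
  obtain ⟨k, hk⟩ := hpe
  obtain rfl : p = 2 * k := by omega
  have hk0 : (0 : ℝ) ≤ k := k.cast_nonneg
  have h4 : (0 : ℝ) ≤ k * 4 ^ k := by positivity
  -- The first summand serves `‖v‖ ≤ 1`, where `x ^ 2 ≤ 9 * ‖v‖ ^ 2`; the second serves `‖v‖ ≥ 1`,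
  -- where `‖1 - v‖ ≤ 2 * ‖v‖`; the third absorbs the leftover linear terms.
  refine ⟨9 * (k * 4 ^ k) + 4 ^ k + 2 * k, by positivity, fun v => ?_⟩
  have hre := Complex.abs_re_le_norm v
  have hre' := abs_le.1 hre
  have hv := norm_nonneg v
  rcases le_total ‖v‖ 1 with h | h
  · rw [pow_mul ‖1 - v‖, norm_one_sub_sq]
    have hx1 : -1 ≤ ‖v‖ ^ 2 - 2 * v.re := by nlinarith [sq_nonneg (‖v‖ - 1)]
    have hx3 : ‖v‖ ^ 2 - 2 * v.re ≤ 3 := by nlinarith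
    have hx2 : (‖v‖ ^ 2 - 2 * v.re) ^ 2 ≤ 9 * ‖v‖ ^ 2 := by
      have h3 : |‖v‖ ^ 2 - 2 * v.re| ≤ 3 * ‖v‖ := abs_le.2 ⟨by nlinarith, by nlinarith⟩
      calc _ ≤ (3 * ‖v‖) ^ 2 := sq_le_sq' (abs_le.1 h3).1 (abs_le.1 h3).2
        _ = _ := by ring
    have := one_add_pow_le_quadratic k hx1 hx3
    have h5 : (0 : ℝ) ≤ ‖v‖ ^ (2 * k) := by positivity
    have h6 : (0 : ℝ) ≤ ‖v‖ ^ 2 := by positivity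
    have h7 := mul_le_mul_of_nonneg_left hx2 h4
    have h8 : 0 ≤ (4 : ℝ) ^ k := by positivity
    push_cast
    nlinarith [mul_nonneg h8 h6, mul_nonneg h8 h5, mul_nonneg hk0 h5, mul_nonneg h4 h5,
      mul_nonneg hk0 h6]
  · have h1 : ‖1 - v‖ ^ (2 * k) ≤ 4 ^ k * ‖v‖ ^ (2 * k) := by
      rw [pow_mul, pow_mul, ← mul_pow]
      gcongr
      rw [norm_one_sub_sq]; nlinarith
    have h5 : (0 : ℝ) ≤ ‖v‖ ^ (2 * k) := by positivity
    have h6 : ‖v‖ ≤ ‖v‖ ^ 2 := by nlinarith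
    have h8 : 0 ≤ (4 : ℝ) ^ k := by positivity
    have h9 : k * v.re ≤ k * ‖v‖ ^ 2 := by gcongr; linarith
    have h10 : 0 ≤ ‖v‖ ^ 2 := by positivity
    push_cast
    nlinarith [mul_nonneg h8 h10, mul_nonneg hk0 h5, mul_nonneg h4 h5, mul_nonneg h4 h10]

/-! ### Circle averages -/

section
variable {p : ℕ} {g φ : ℂ → ℂ} {r : ℝ}

lemma continuousOn_sphere_of_differentiableOn (hg : DifferentiableOn ℂ g (ball 0 1))
    (h0 : 0 ≤ r) (h1 : r < 1) : ContinuousOn g (sphere 0 |r|) := by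
  refine hg.continuousOn.mono fun z hz => ?_
  rw [abs_of_nonneg h0, mem_sphere_zero_iff_norm] at hz
  rw [mem_ball_zero_iff, hz]; exact h1

lemma circleAverage_eq_of_differentiableOn (hg : DifferentiableOn ℂ g (ball 0 1))
    (h0 : 0 ≤ r) (h1 : r < 1) : circleAverage g 0 r = g 0 := by
  refine DiffContOnCl.circleAverage (hg.mono ?_).diffContOnCl
  refine closure_ball_subset_closedBall.trans (closedBall_subset_ball ?_)
  rwa [abs_of_nonneg h0]

/-- The integral mean of `‖g‖ ^ 2 + ‖g‖ ^ p` over the circle of radius `r`. -/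
noncomputable def energyMean (p : ℕ) (g : ℂ → ℂ) (r : ℝ) : ℝ :=
  circleAverage (fun z => ‖g z‖ ^ 2 + ‖g z‖ ^ p) 0 r

lemma hardyMean_eq_circleAverage (p : ℕ) (g : ℂ → ℂ) (r : ℝ) :
    hardyMean p g r = circleAverage (fun z => ‖g z‖ ^ p) 0 r := by
  simp [hardyMean, circleAverage_def]

lemma hardyMean_nonneg (p : ℕ) (g : ℂ → ℂ) (r : ℝ) : 0 ≤ hardyMean p g r := by
  rw [hardyMean_eq_circleAverage]
  exact circleAverage_nonneg_of_nonneg fun _ _ => by positivity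

/-- By the mean value property the linear term sees only `g 0`, whatever the radius. -/
lemma circleAverage_taylor (hg : DifferentiableOn ℂ g (ball 0 1)) (h0 : 0 ≤ r) (h1 : r < 1)
    (c : ℝ) :
    circleAverage (fun z => 1 - p * (g z).re + c * (‖g z‖ ^ 2 + ‖g z‖ ^ p)) 0 r
      = 1 - p * (g 0).re + c * energyMean p g r := by
  have hc := continuousOn_sphere_of_differentiableOn hg h0 h1
  have hre : circleAverage (fun z => (g z).re) 0 r = (g 0).re := by
    have := Complex.reCLM.circleAverage_comp_comm (ContinuousOn.circleIntegrable' hc)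
    rw [circleAverage_eq_of_differentiableOn hg h0 h1] at this
    exact this
  have e1 := circleAverage_fun_smul (a := (p : ℝ)) (f := fun z => (g z).re) (c := 0) (R := r)
  have e2 := circleAverage_fun_smul (a := c) (f := fun z => ‖g z‖ ^ 2 + ‖g z‖ ^ p)
    (c := 0) (R := r)
  simp only [smul_eq_mul] at e1 e2
  have hI1 : CircleIntegrable (fun z => (p : ℝ) * (g z).re) 0 r :=
    ContinuousOn.circleIntegrable' (continuousOn_const.mul (Complex.continuous_re.comp_continuousOn hc))
  have hI2 : CircleIntegrable (fun z => c * (‖g z‖ ^ 2 + ‖g z‖ ^ p)) 0 r :=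
    ContinuousOn.circleIntegrable' (by fun_prop)
  have hI3 : CircleIntegrable (fun z => 1 - (p : ℝ) * (g z).re) 0 r :=
    ContinuousOn.circleIntegrable' (continuousOn_const.sub
      (continuousOn_const.mul (Complex.continuous_re.comp_continuousOn hc)))
  rw [circleAverage_fun_add hI3 hI2,
    circleAverage_fun_sub (circleIntegrable_const _ _ _) hI1, e1, e2, hre, circleAverage_const]
  rfl

lemma le_hardyMean_one_sub (hg : DifferentiableOn ℂ g (ball 0 1)) (h0 : 0 ≤ r) (h1 : r < 1)
    {c : ℝ} (hc : ∀ v : ℂ, 1 - p * v.re + c * (‖v‖ ^ 2 + ‖v‖ ^ p) ≤ ‖1 - v‖ ^ p) :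
    1 - p * (g 0).re + c * energyMean p g r ≤ hardyMean p (fun z => 1 - g z) r := by
  have hcont := continuousOn_sphere_of_differentiableOn hg h0 h1
  rw [← circleAverage_taylor hg h0 h1, hardyMean_eq_circleAverage]
  refine circleAverage_mono (ContinuousOn.circleIntegrable' ?_)
    (ContinuousOn.circleIntegrable' (by fun_prop)) fun z _ => hc _
  have := Complex.continuous_re.comp_continuousOn hcont
  exact (continuousOn_const.sub (continuousOn_const.mul this)).add (by fun_prop)

lemma hardyMean_one_sub_le (hg : DifferentiableOn ℂ g (ball 0 1)) (h0 : 0 ≤ r) (h1 : r < 1)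
    {C : ℝ} (hC : ∀ v : ℂ, ‖1 - v‖ ^ p ≤ 1 - p * v.re + C * (‖v‖ ^ 2 + ‖v‖ ^ p)) :
    hardyMean p (fun z => 1 - g z) r ≤ 1 - p * (g 0).re + C * energyMean p g r := by
  have hcont := continuousOn_sphere_of_differentiableOn hg h0 h1
  rw [← circleAverage_taylor hg h0 h1, hardyMean_eq_circleAverage]
  refine circleAverage_mono (ContinuousOn.circleIntegrable' (by fun_prop))
    (ContinuousOn.circleIntegrable' ?_) fun z _ => hC _
  have := Complex.continuous_re.comp_continuousOn hcont
  exact (continuousOn_const.sub (continuousOn_const.mul this)).add (by fun_prop)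

lemma energyMean_nonneg (p : ℕ) (g : ℂ → ℂ) (r : ℝ) : 0 ≤ energyMean p g r :=
  circleAverage_nonneg_of_nonneg fun _ _ => by positivity

/-- If `‖g‖ ≤ M ‖h‖` on a circle, then the energy of `g` is controlled by that of `h`. -/
lemma energyMean_le_of_norm_le {h : ℂ → ℂ} (hg : DifferentiableOn ℂ g (ball 0 1))
    (hh : DifferentiableOn ℂ h (ball 0 1)) (h0 : 0 ≤ r) (h1 : r < 1) {M D : ℝ}
    (hM2 : M ^ 2 ≤ D) (hMp : M ^ p ≤ D)
    (hle : ∀ z, ‖z‖ = r → ‖g z‖ ≤ M * ‖h z‖) :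
    energyMean p g r ≤ D * energyMean p h r := by
  have hcg := continuousOn_sphere_of_differentiableOn hg h0 h1
  have hch := continuousOn_sphere_of_differentiableOn hh h0 h1
  have e := circleAverage_fun_smul (a := D) (f := fun z => ‖h z‖ ^ 2 + ‖h z‖ ^ p)
    (c := 0) (R := r)
  simp only [smul_eq_mul] at e
  rw [energyMean, energyMean, ← e]
  refine circleAverage_mono (ContinuousOn.circleIntegrable' (by fun_prop))
    (ContinuousOn.circleIntegrable' (by fun_prop)) fun z hz => ?_
  rw [abs_of_nonneg h0, mem_sphere_zero_iff_norm] at hz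
  have h2 := hle z hz
  calc ‖g z‖ ^ 2 + ‖g z‖ ^ p ≤ (M * ‖h z‖) ^ 2 + (M * ‖h z‖) ^ p := by gcongr
    _ = M ^ 2 * ‖h z‖ ^ 2 + M ^ p * ‖h z‖ ^ p := by ring
    _ ≤ D * ‖h z‖ ^ 2 + D * ‖h z‖ ^ p := by gcongr
    _ = _ := by ring

/-- Cauchy's formula for `φ ^ n` bounds `φ` on a smaller disk by its means. -/
lemma norm_pow_le_circleAverage (hφ : DifferentiableOn ℂ φ (ball 0 1)) (n : ℕ) {w : ℂ}
    (hw : ‖w‖ ≤ 3 / 4) :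
    ‖φ w‖ ^ n ≤ 7 * circleAverage (fun z => ‖φ z‖ ^ n) 0 (7 / 8) := by
  have habs : |(7 / 8 : ℝ)| = 7 / 8 := abs_of_pos (by norm_num)
  have hcφ := continuousOn_sphere_of_differentiableOn hφ (r := 7 / 8) (by norm_num) (by norm_num)
  have hd : DiffContOnCl ℂ (fun z => φ z ^ n) (ball 0 |(7 / 8 : ℝ)|) := by
    refine ((hφ.pow n).mono ?_).diffContOnCl
    refine closure_ball_subset_closedBall.trans (closedBall_subset_ball ?_)
    rw [habs]; norm_num
  have hmem : w ∈ ball (0 : ℂ) |(7 / 8 : ℝ)| := by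
    rw [habs, mem_ball_zero_iff]; linarith
  have key := hd.circleAverage_smul_div hmem
  have e := circleAverage_fun_smul (a := (7 : ℝ)) (f := fun z => ‖φ z‖ ^ n) (c := 0) (R := 7 / 8)
  simp only [smul_eq_mul] at e
  -- The factor 7 is `(7 / 8) / (1 / 8)`, a bound for the Cauchy kernel.
  have hne : ∀ z ∈ sphere (0 : ℂ) |(7 / 8 : ℝ)|, 1 / 8 ≤ ‖z - w‖ := fun z hz => by
    rw [habs, mem_sphere_zero_iff_norm] at hz
    linarith [norm_sub_norm_le z w]
  rw [← norm_pow, ← key, ← e]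
  have h1 : ‖circleAverage (fun z => ((z - 0) / (z - w)) • φ z ^ n) 0 (7 / 8)‖ ≤
      circleAverage (fun z => ‖((z - 0) / (z - w)) • φ z ^ n‖) 0 (7 / 8) := by
    rw [circleAverage_def, circleAverage_def, norm_smul, norm_of_nonneg (by positivity),
      smul_eq_mul]
    gcongr
    exact intervalIntegral.norm_integral_le_integral_norm (by positivity)
  refine h1.trans (circleAverage_mono (ContinuousOn.circleIntegrable' ?_)
    (ContinuousOn.circleIntegrable' (by fun_prop)) fun z hz => ?_)
  · refine ContinuousOn.norm (ContinuousOn.smul (ContinuousOn.div (continuousOn_id.sub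
      continuousOn_const) (continuousOn_id.sub continuousOn_const) fun z hz h => ?_)
      (hcφ.pow n))
    have := hne z hz
    rw [show z - w = 0 from h, norm_zero] at this
    linarith
  · have h2 := hne z hz
    rw [habs, mem_sphere_zero_iff_norm] at hz
    rw [norm_smul, norm_div, sub_zero, hz, norm_pow]
    gcongr
    rw [div_le_iff₀ (by linarith)]; linarith

/-- Carries energy bounds to inner circles, where `z - w` may vanish and division by it fails. -/
lemma energyMean_le_of_le (hφ : DifferentiableOn ℂ φ (ball 0 1)) (h0 : 0 ≤ r)
    (hr : r ≤ 3 / 4) : energyMean p φ r ≤ 7 * energyMean p φ (7 / 8) := by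
  have hc := continuousOn_sphere_of_differentiableOn hφ h0 (by linarith)
  have hc' := continuousOn_sphere_of_differentiableOn hφ (r := 7 / 8) (by norm_num) (by norm_num)
  refine circleAverage_mono_on_of_le_circle (ContinuousOn.circleIntegrable' (by fun_prop))
    fun z hz => ?_
  rw [abs_of_nonneg h0, mem_sphere_zero_iff_norm] at hz
  rw [energyMean, circleAverage_fun_add (ContinuousOn.circleIntegrable' (by fun_prop))
    (ContinuousOn.circleIntegrable' (by fun_prop)), mul_add]
  exact add_le_add (norm_pow_le_circleAverage hφ 2 (hz.le.trans hr))
    (norm_pow_le_circleAverage hφ p (hz.le.trans hr))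

end

/-! ### Comparison of approximants -/

section
variable {p : ℕ} {f : ℂ → ℂ}

lemma MemHardy.exists_energyMean_le (hp : 2 ≤ p) (hf : MemHardy p f) :
    ∃ K : ℝ, 0 ≤ K ∧ ∀ r, 0 ≤ r → r < 1 → energyMean p f r ≤ K := by
  obtain ⟨B, hB⟩ := hf.2
  have hB' : ∀ r, 0 ≤ r → r < 1 → hardyMean p f r ≤ B := fun r h0 h1 => hB ⟨r, ⟨h0, h1⟩, rfl⟩
  have hB0 : 0 ≤ B := (hardyMean_nonneg p f 0).trans (hB' 0 le_rfl one_pos)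
  refine ⟨1 + 2 * B, by positivity, fun r h0 h1 => ?_⟩
  have hc := continuousOn_sphere_of_differentiableOn hf.1 h0 h1
  have hI : CircleIntegrable (fun z => ‖f z‖ ^ p) 0 r :=
    ContinuousOn.circleIntegrable' (by fun_prop)
  calc energyMean p f r ≤ circleAverage (fun z => 1 + (2 : ℝ) • ‖f z‖ ^ p) 0 r := by
        refine circleAverage_mono (ContinuousOn.circleIntegrable' (by fun_prop))
          (ContinuousOn.circleIntegrable' (by fun_prop)) fun z _ => ?_
        rw [smul_eq_mul]
        have h3 : 0 ≤ ‖f z‖ ^ p := by positivity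
        rcases le_total ‖f z‖ 1 with h | h
        · have : ‖f z‖ ^ 2 ≤ 1 := pow_le_one₀ (norm_nonneg _) h
          linarith
        · have : ‖f z‖ ^ 2 ≤ ‖f z‖ ^ p := pow_le_pow_right₀ h hp
          linarith
    _ = 1 + 2 * hardyMean p f r := by
        rw [circleAverage_fun_add (circleIntegrable_const _ _ _)
          (ContinuousOn.circleIntegrable' (by fun_prop)), circleAverage_const,
          circleAverage_fun_smul, hardyMean_eq_circleAverage, smul_eq_mul]
    _ ≤ 1 + 2 * B := by linarith [hB' r h0 h1]

/-- Multiplication by a polynomial and subtraction from `1` preserve bounded means. -/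
lemma MemHardy.bddAbove_one_sub (hp : 2 ≤ p) (hpe : Even p) (hf : MemHardy p f)
    (s : Polynomial ℂ) :
    BddAbove (hardyMean p (fun z => 1 - s.eval z * f z) '' Ico 0 1) := by
  obtain ⟨K, hK0, hK⟩ := hf.exists_energyMean_le hp
  obtain ⟨C, hC0, hC⟩ := exists_norm_one_sub_pow_le hpe
  obtain ⟨M, hM⟩ := (isCompact_closedBall (0 : ℂ) 1).exists_bound_of_continuousOn
    (s.continuous.continuousOn)
  have hd : DifferentiableOn ℂ (fun z => s.eval z * f z) (ball 0 1) :=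
    s.differentiable.differentiableOn.mul hf.1
  refine ⟨1 - p * (s.eval 0 * f 0).re + C * (max 1 M ^ p * K), ?_⟩
  rintro _ ⟨r, ⟨h0, h1⟩, rfl⟩
  refine (hardyMean_one_sub_le hd h0 h1 hC).trans ?_
  gcongr
  refine (energyMean_le_of_norm_le hd hf.1 h0 h1 (M := max 1 M)
    (pow_le_pow_right₀ (le_max_left 1 M) hp) le_rfl fun z hz => ?_).trans
    (by gcongr; exact hK r h0 h1)
  rw [norm_mul]
  gcongr
  exact (hM z (by rw [mem_closedBall_zero_iff, hz]; exact h1.le)).trans (le_max_right _ _)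

/-- The means of the optimal residual are bounded by any common bound of the means of a
competitor. -/
lemma IsOPA.hardyMean_le {n : ℕ} {q : Polynomial ℂ} (hp : 2 ≤ p) (hpe : Even p)
    (hf : MemHardy p f) (hq : IsOPA n p f q) {s : Polynomial ℂ} (hs : s.natDegree ≤ n) {B : ℝ}
    (hB : ∀ r, 0 ≤ r → r < 1 → hardyMean p (fun z => 1 - s.eval z * f z) r ≤ B)
    {r : ℝ} (h0 : 0 ≤ r) (h1 : r < 1) :
    hardyMean p (fun z => 1 - q.eval z * f z) r ≤ B := by
  have hpos : ∀ t : Polynomial ℂ,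
      0 ≤ sSup (hardyMean p (fun z => 1 - t.eval z * f z) '' Ico 0 1) := fun t =>
    Real.sSup_nonneg (by rintro _ ⟨r, -, rfl⟩; exact hardyMean_nonneg p _ r)
  have h := hq.2 s hs
  have hp0 : (0 : ℝ) < 1 / p := by
    have : (0 : ℝ) < p := by exact_mod_cast (by omega : 0 < p)
    positivity
  rw [hardyNorm, hardyNorm, Real.rpow_le_rpow_iff (hpos q) (hpos s) hp0] at h
  calc _ ≤ sSup (hardyMean p (fun z => 1 - q.eval z * f z) '' Ico 0 1) :=
        le_csSup (hf.bddAbove_one_sub hp hpe q) ⟨r, ⟨h0, h1⟩, rfl⟩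
    _ ≤ _ := h
    _ ≤ B := csSup_le ⟨_, 0, ⟨le_rfl, one_pos⟩, rfl⟩
        (by rintro _ ⟨r, ⟨h0, h1⟩, rfl⟩; exact hB r h0 h1)

/-- If `f 0 ≠ 0`, then no optimal approximant vanishes identically. -/
lemma IsOPA.ne_zero {n : ℕ} {q : Polynomial ℂ} (hp : 2 ≤ p) (hpe : Even p)
    (hf : MemHardy p f) (hf0 : f 0 ≠ 0) (hq : IsOPA n p f q) : q ≠ 0 := by
  rintro rfl
  obtain ⟨C, hC0, hC⟩ := exists_norm_one_sub_pow_le hpe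
  obtain ⟨K, hK0, hK⟩ := hf.exists_energyMean_le hp
  have hn : 0 < ‖f 0‖ := norm_pos_iff.2 hf0
  -- A small step along `conj (f 0)`: the gain `p * t * ‖f 0‖ ^ 2` exceeds the cost `C * t ^ 2 * ‖f
  -- 0‖ ^ 2 * K` because `t * (C * K) ≤ 1 < p`.
  set t : ℝ := (1 + ‖f 0‖ + C * K)⁻¹ with ht
  have hden : 0 < 1 + ‖f 0‖ + C * K := by positivity
  have ht0 : 0 < t := inv_pos.2 hden
  have ht1 : t * (1 + ‖f 0‖ + C * K) = 1 := inv_mul_cancel₀ hden.ne'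
  have hCK : 0 ≤ C * K := by positivity
  have htn : t * ‖f 0‖ ≤ 1 := by nlinarith
  have htK : t * (C * K) ≤ 1 := by nlinarith
  set b : ℂ := t * (starRingEnd ℂ) (f 0) with hb
  have hbn : ‖b‖ = t * ‖f 0‖ := by
    rw [hb, norm_mul, Complex.norm_real, norm_of_nonneg ht0.le, RCLike.norm_conj]
  have hbf : (b * f 0).re = t * ‖f 0‖ ^ 2 := by
    rw [hb, mul_assoc, Complex.conj_mul', ← Complex.ofReal_pow, ← Complex.ofReal_mul,
      Complex.ofReal_re]
  have hd : DifferentiableOn ℂ (fun z => b * f z) (ball 0 1) := hf.1.const_mul b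
  have hle := hq.hardyMean_le hp hpe hf (s := Polynomial.C b) (by simp)
    (B := 1 - p * (t * ‖f 0‖ ^ 2) + C * ((t * ‖f 0‖) ^ 2 * K)) (fun r h0 h1 => by
      simp only [Polynomial.eval_C]
      refine (hardyMean_one_sub_le hd h0 h1 hC).trans ?_
      rw [hbf]
      gcongr
      refine (energyMean_le_of_norm_le hd hf.1 h0 h1 (M := t * ‖f 0‖) le_rfl
        (pow_le_pow_of_le_one (by positivity) htn hp) fun z _ => ?_).trans
        (by gcongr; exact hK r h0 h1)
      rw [norm_mul, hbn]) (r := 0) le_rfl one_pos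
  have hone : hardyMean p (fun z => 1 - (0 : Polynomial ℂ).eval z * f z) 0 = 1 := by
    rw [hardyMean_eq_circleAverage]
    simp
  rw [hone] at hle
  have h2 : (2 : ℝ) ≤ p := by exact_mod_cast hp
  have hpos : 0 < t * ‖f 0‖ ^ 2 := by positivity
  nlinarith

end

/-! ### ### Linear approximants with a root near the origin -/

lemma neg_norm_mul_le_neg_re (a w b : ℂ) : -(‖w‖ * ‖a * b‖) ≤ -(a * (0 - w) * b).re := by
  have := Complex.re_le_norm (a * (0 - w) * b)
  rw [show ‖a * (0 - w) * b‖ = ‖w‖ * ‖a * b‖ by simp; ring] at this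
  linarith

/-- For an optimal approximant with a root `w` close to the origin, the energy of `a f` is
controlled by its value at the origin, with a factor `‖w‖`. -/
lemma IsOPA.energyMean_le {p : ℕ} (hp : 2 ≤ p) (hpe : Even p) {c : ℝ} (hc0 : 0 < c)
    (hc : ∀ v : ℂ, 1 - p * v.re + c * (‖v‖ ^ 2 + ‖v‖ ^ p) ≤ ‖1 - v‖ ^ p)
    {f : ℂ → ℂ} (hf : MemHardy p f) {a w : ℂ} (hw : ‖w‖ ≤ 1 / 4)
    (hq : IsOPA 1 p f (Polynomial.C a * (Polynomial.X - Polynomial.C w)))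
    {r : ℝ} (h0 : 0 ≤ r) (h1 : r < 1) :
    energyMean p (fun z => a * f z) r ≤ 7 * (2 ^ p * (c⁻¹ * (p * (‖w‖ * ‖a * f 0‖)))) := by
  have hφ : DifferentiableOn ℂ (fun z => a * f z) (ball 0 1) := hf.1.const_mul a
  have hu : DifferentiableOn ℂ (fun z => a * (z - w) * f z) (ball 0 1) := by
    have := hf.1
    fun_prop
  have hp0 : (0 : ℝ) ≤ p := p.cast_nonneg
  have hre : -(‖w‖ * ‖a * f 0‖) ≤ -(a * (0 - w) * f 0).re :=
    neg_norm_mul_le_neg_re a w (f 0)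
  have key : ∀ r : ℝ, 3 / 4 ≤ r → r < 1 →
      energyMean p (fun z => a * f z) r ≤ 2 ^ p * (c⁻¹ * (p * (‖w‖ * ‖a * f 0‖))) := by
    intro r hr h1
    have h0 : 0 ≤ r := by linarith
    -- The competitor is the zero polynomial, whose residual is 1.
    have hopt := hq.hardyMean_le hp hpe hf (s := 0) (by simp) (B := 1) (fun r _ _ => by
      rw [hardyMean_eq_circleAverage]
      simp [circleAverage_const]) h0 h1
    simp only [Polynomial.eval_mul, Polynomial.eval_sub, Polynomial.eval_C,
      Polynomial.eval_X] at hopt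
    have hlow := (le_hardyMean_one_sub hu h0 h1 hc).trans hopt
    have hE : energyMean p (fun z => a * (z - w) * f z) r ≤ c⁻¹ * (p * (‖w‖ * ‖a * f 0‖)) := by
      rw [le_inv_mul_iff₀ hc0]
      have := mul_le_mul_of_nonneg_left hre hp0
      linarith
    refine (energyMean_le_of_norm_le hφ hu h0 h1 (M := 2)
      (pow_le_pow_right₀ one_le_two hp) le_rfl fun z hz => ?_).trans (by gcongr)
    have h2 : 1 / 2 ≤ ‖z - w‖ := by linarith [norm_sub_norm_le z w]
    rw [show a * (z - w) * f z = (z - w) * (a * f z) by ring, norm_mul (z - w)]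
    nlinarith [norm_nonneg (a * f z)]
  have hK : 0 ≤ 2 ^ p * (c⁻¹ * (p * (‖w‖ * ‖a * f 0‖))) := by positivity
  rcases le_total r (3 / 4) with h | h
  · refine (energyMean_le_of_le hφ h0 h).trans ?_
    gcongr
    exact key _ (by norm_num) (by norm_num)
  · linarith [key r h h1]

theorem mainTheorem1 (p : ℕ) (hp : 2 < p) (hpe : Even p) :
    ∃ ρ : ℝ, 0 < ρ ∧
      ∀ f : ℂ → ℂ, MemHardy p f → f 0 ≠ 0 →
        ∀ a w : ℂ, IsOPA 1 p f (Polynomial.C a * (Polynomial.X - Polynomial.C w)) → ρ ≤ ‖w‖ := by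
  obtain ⟨c, hc0, hc⟩ := exists_le_norm_one_sub_pow hp hpe
  obtain ⟨C, hC0, hC⟩ := exists_norm_one_sub_pow_le hpe
  have hp0 : (0 : ℝ) < p := by exact_mod_cast (by omega : 0 < p)
  set L : ℝ := C * (2 ^ p * (7 * (2 ^ p * (c⁻¹ * p)))) with hL
  have hL0 : 0 < L := by positivity
  -- The comparison will give `p ≤ (p + L) * ‖w‖`; the bound `1 / 4` keeps `w` away from the circles
  -- `‖z‖ ≥ 3 / 4`.
  refine ⟨min (1 / 4) (p / (p + L)), by positivity, fun f hf hf0 a w hq => ?_⟩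
  by_contra! hlt
  have hw : ‖w‖ ≤ 1 / 4 := (hlt.trans_le (min_le_left _ _)).le
  have ha : a ≠ 0 := by
    rintro rfl
    exact hq.ne_zero hp.le hpe hf hf0 (by simp)
  have hφ0 : 0 < ‖a * f 0‖ := norm_pos_iff.2 (mul_ne_zero ha hf0)
  obtain ⟨σ, hσ, hσφ⟩ : ∃ σ : ℂ, ‖σ‖ = 1 ∧ σ * (a * f 0) = (‖a * f 0‖ : ℂ) := by
    refine ⟨‖a * f 0‖ / (a * f 0), ?_, div_mul_cancel₀ _ (norm_pos_iff.1 hφ0)⟩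
    rw [norm_div, Complex.norm_real, norm_norm, div_self hφ0.ne']
  have hφ : DifferentiableOn ℂ (fun z => a * f z) (ball 0 1) := hf.1.const_mul a
  have hu : ∀ b : ℂ, DifferentiableOn ℂ (fun z => a * (z - b) * f z) (ball 0 1) := fun b => by
    have := hf.1
    fun_prop
  have hle := hq.hardyMean_le hp.le hpe hf
    (s := Polynomial.C a * (Polynomial.X - Polynomial.C (-σ)))
    ((Polynomial.natDegree_C_mul_le _ _).trans (Polynomial.natDegree_X_sub_C_le _))
    (B := 1 - p * ‖a * f 0‖ + L * (‖w‖ * ‖a * f 0‖)) (fun r h0 h1 => by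
      simp only [Polynomial.eval_mul, Polynomial.eval_sub, Polynomial.eval_C, Polynomial.eval_X]
      refine (hardyMean_one_sub_le (hu (-σ)) h0 h1 hC).trans ?_
      have e : a * (0 - -σ) * f 0 = (‖a * f 0‖ : ℂ) := by rw [← hσφ]; ring
      rw [e, Complex.ofReal_re, hL, show C * (2 ^ p * (7 * (2 ^ p * (c⁻¹ * p)))) *
        (‖w‖ * ‖a * f 0‖) = C * (2 ^ p * (7 * (2 ^ p * (c⁻¹ * (p * (‖w‖ * ‖a * f 0‖)))))) by ring]
      gcongr
      refine (energyMean_le_of_norm_le (hu (-σ)) hφ h0 h1 (M := 2)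
        (pow_le_pow_right₀ one_le_two hp.le) le_rfl fun z hz => ?_).trans
        (by gcongr; exact hq.energyMean_le hp.le hpe hc0 hc hf hw h0 h1)
      rw [show a * (z - -σ) * f z = (z + σ) * (a * f z) by ring, norm_mul]
      gcongr
      linarith [norm_add_le z σ]) (r := 0) le_rfl one_pos
  simp only [Polynomial.eval_mul, Polynomial.eval_sub, Polynomial.eval_C,
    Polynomial.eval_X] at hle
  -- The energy of the optimal product enters only through its sign, so radius 0 suffices.
  have hlow := (le_hardyMean_one_sub (hu w) le_rfl one_pos hc).trans hle
  have hE := mul_nonneg hc0.le (energyMean_nonneg p (fun z => a * (z - w) * f z) 0)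
  have hre : -(‖w‖ * ‖a * f 0‖) ≤ -(a * (0 - w) * f 0).re :=
    neg_norm_mul_le_neg_re a w (f 0)
  have hre' := mul_le_mul_of_nonneg_left hre hp0.le
  have hfin : p * ‖a * f 0‖ ≤ (p + L) * ‖w‖ * ‖a * f 0‖ := by linarith
  have h3 := le_of_mul_le_mul_right hfin hφ0
  have h4 := hlt.trans_le (min_le_right _ _)
  rw [lt_div_iff₀ (by positivity)] at h4
  linarith
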